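/- Let $X$ be a complex Banach space and let $S$ be a densely defined linear operator in $X$ with domain $\mathcal D(S)\subset X$. Let $\varrho(S)$ be the set of $\lambda\in\mathbb C$ such that $S-\lambda:\mathcal D(S)\to X$ is bijective with bounded inverse. Suppose that $0\in\varrho(S)$ and that $S$ is bisectorial, i.e. $i\mathbb R\setminus\{0\}\subset\varrho(S)$ and there is a constant $M$ with $\|(S-\lambda)^{-1}\|\le M/|\lambda|$ for all $\lambda\in i\mathbb R\setminus\{0\}$. Let $G_+$ (respectively $G_-$) be the subspace of all $x\in X$ for which the function $\lambda\mapsto(S-\lambda)^{-1}x$ on $\varrho(S)$ extends to a function on the union of $\varrho(S)$ and the closed left half-plane $\{\operatorname{Re}\lambda\le0\}$ (respectively the closed right half-plane $\{\operatorname{Re}\lambda\ge0\}$) that is analytic on a neighbourhood of this union and bounded on that closed half-plane. Let $S|G_\pm$ be the restriction of $S$ to $G_\pm$, with domain $\mathcal D(S)\cap G_\pm$. Then: 1. $S|G_+$ and $S|G_-$ are densely defined, i.e. $\mathcal D(S)\cap G_\pm$ is dense in $G_\pm$. 2. There is $h>0$ such that $$\{\lambda\in\mathbb C:|\operatorname{Re}\lambda|\le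 h\}\subset\varrho(S)\quad\text{and}\quad\sup_{|\operatorname{Re}\lambda|\le h}\|(S-\lambda)^{-1}\|<\infty .\qquad(*)$$ For every $h>0$ satisfying $(*)$, the integrals $$A_\pm=\frac{\pm1}{2\pi i}\int_{\pm h-i\infty}^{\pm h+i\infty}\frac1{\lambda^2}(S-\lambda)^{-1}\,d\lambda$$ converge absolutely in the Banach space $L(X)$ of bounded linear operators on $X$, and the subspaces $M_\pm:=\overline{\operatorname{ran}(A_\pm)}$ satisfy $M_+=G_+$ and $M_-=G_-$. -/

import Mathlib

noncomputable section

namespace UnboundedOp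

variable {X : Type*} [NormedAddCommGroup X] [NormedSpace ℂ X]

/-- `R` is a bounded, everywhere defined two-sided inverse of `S - l`, where
`S - l` has domain `D(S)`. -/
def IsResolventAt (S : X →ₗ.[ℂ] X) (l : ℂ) (R : X →L[ℂ] X) : Prop :=
  (∀ x : X, ∃ h : R x ∈ S.domain, S ⟨R x, h⟩ - l • R x = x) ∧
  (∀ x : S.domain, R (S x - l • (x : X)) = x)

/-- The resolvent set of `S`: all `l` such that `S - l : D(S) → X` is bijective with bounded
inverse. -/
def rho (S : X →ₗ.[ℂ] X) : Set ℂ := {l | ∃ R : X →L[ℂ] X, IsResolventAt S l R}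

open Classical in
/-- The resolvent `(S - l)⁻¹` for `l ∈ rho S` (and the default value `0` elsewhere). -/
def res (S : X →ₗ.[ℂ] X) (l : ℂ) : X →L[ℂ] X :=
  if h : ∃ R : X →L[ℂ] X, IsResolventAt S l R then h.choose else 0

/-- `S` is bisectorial: every nonzero `l` on the imaginary axis lies in the resolvent set, and
`‖(S - l)⁻¹‖ ≤ M / |l|` for all these `l`, with one constant `M`. -/
def IsBisectorial (S : X →ₗ.[ℂ] X) : Prop :=
  ∃ M : ℝ, ∀ l : ℂ, l.re = 0 → l ≠ 0 → l ∈ rho S ∧ ‖res S l‖ ≤ M / ‖l‖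

/-- For a subset `H` of the plane, the subspace of all `x` such that `l ↦ (S - l)⁻¹ x`, defined on
`rho S`, has an extension to `H ∪ rho S` that is analytic (on a neighbourhood of `H ∪ rho S`)
and bounded on `H`. -/
def extSubspace (S : X →ₗ.[ℂ] X) (H : Set ℂ) : Submodule ℂ X where
  carrier := {x | ∃ f : ℂ → X, AnalyticOnNhd ℂ f (H ∪ rho S) ∧
    (∀ l ∈ rho S, f l = res S l x) ∧ ∃ C : ℝ, ∀ l ∈ H, ‖f l‖ ≤ C}
  zero_mem' := ⟨fun _ => 0, analyticOnNhd_const, by simp, 0, by simp⟩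
  add_mem' := by
    rintro x y ⟨f, hf, hfx, C, hC⟩ ⟨g, hg, hgy, D, hD⟩
    refine ⟨f + g, hf.add hg, fun l hl => ?_, C + D, fun l hl => ?_⟩
    · simp [hfx l hl, hgy l hl]
    · exact (norm_add_le _ _).trans (add_le_add (hC l hl) (hD l hl))
  smul_mem' := by
    rintro c x ⟨f, hf, hfx, C, hC⟩
    refine ⟨fun l => c • f l, fun l hl => (hf l hl).const_smul, fun l hl => ?_, ‖c‖ * C,
      fun l hl => ?_⟩
    · simp [hfx l hl]
    · rw [norm_smul]
      exact mul_le_mul_of_nonneg_left (hC l hl) (norm_nonneg c)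

/-- `G₊`: bounded analytic extension to the closed left half-plane. -/
def Gplus (S : X →ₗ.[ℂ] X) : Submodule ℂ X := extSubspace S {l : ℂ | l.re ≤ 0}

/-- `G₋`: bounded analytic extension to the closed right half-plane. -/
def Gminus (S : X →ₗ.[ℂ] X) : Submodule ℂ X := extSubspace S {l : ℂ | 0 ≤ l.re}

/-- The restriction `S|Z`, with domain `D(S) ∩ Z`, as an operator on the space `Z`. -/
def restr (S : X →ₗ.[ℂ] X) (Z : Submodule ℂ X) : Z →ₗ.[ℂ] X where
  domain := S.domain.comap Z.subtype
  toFun := S.toFun ∘ₗ (Z.subtype.restrict fun _ hx => hx)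

/-- The operator is densely defined. -/
def IsDenselyDefined {Y : Type*} [NormedAddCommGroup Y] [NormedSpace ℂ Y] (T : Y →ₗ.[ℂ] X) :
    Prop :=
  Dense (T.domain : Set Y)

/-- The closed strip `|Re l| ≤ h`, with `h > 0`, lies in the resolvent set and the resolvent is
bounded on it. -/
def StripBounded (S : X →ₗ.[ℂ] X) (h : ℝ) : Prop :=
  0 < h ∧ (∀ l : ℂ, |l.re| ≤ h → l ∈ rho S) ∧ ∃ M : ℝ, ∀ l : ℂ, |l.re| ≤ h → ‖res S l‖ ≤ M

/-- The integrand `l⁻² (S - l)⁻¹`. -/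
def integrand (S : X →ₗ.[ℂ] X) (l : ℂ) : X →L[ℂ] X := (1 / l ^ 2) • res S l

/-- `∫ f(l) dl` along the upward vertical line `Re l = c`, i.e. `l = c + i t`, `dl = i dt`. -/
def lineIntegral {E : Type*} [NormedAddCommGroup E] [NormedSpace ℂ E] (f : ℂ → E) (c : ℝ) : E :=
  Complex.I • ∫ t : ℝ, f (c + t * Complex.I)

/-- `A₊ = 1/(2πi) ∫_{h-i∞}^{h+i∞} l⁻² (S - l)⁻¹ dl`. -/
def Aplus (S : X →ₗ.[ℂ] X) (h : ℝ) : X →L[ℂ] X :=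
  (1 / (2 * Real.pi * Complex.I)) • lineIntegral (integrand S) h

/-- `A₋ = -1/(2πi) ∫_{-h-i∞}^{-h+i∞} l⁻² (S - l)⁻¹ dl`. -/
def Aminus (S : X →ₗ.[ℂ] X) (h : ℝ) : X →L[ℂ] X :=
  (-1 / (2 * Real.pi * Complex.I)) • lineIntegral (integrand S) (-h)

/-- `M₊`, the closure of the range of `A₊`. -/
def Mplus (S : X →ₗ.[ℂ] X) (h : ℝ) : Submodule ℂ X :=
  (LinearMap.range (Aplus S h).toLinearMap).topologicalClosure

/-- `M₋`, the closure of the range of `A₋`. -/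
def Mminus (S : X →ₗ.[ℂ] X) (h : ℝ) : Submodule ℂ X :=
  (LinearMap.range (Aminus S h).toLinearMap).topologicalClosure

end UnboundedOp

end

/-! ### Resolvent calculus and the strip around the imaginary axis -/

noncomputable section

namespace UnboundedOp

open Complex Filter Topology MeasureTheory

variable {X : Type*} [NormedAddCommGroup X] [NormedSpace ℂ X]

/-! Write R(l) = (S - l)⁻¹. The core of the proof is the identity G₊ = ker (A₊ - R(0)²), which is
`StripBounded.mem_Gplus_iff`; it makes G₊ closed. It rests on the Taylor identity R(l)x = R(0)x + l
R(0)²x + l² R(0)² R(l)x.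

If x ∈ G₊, the extension f of the orbit is bounded on Re l ≤ h, so the integral of l⁻² f(l) over Re
l = h can be closed to the left; only the residue f'(0) = R(0)²x at 0 survives, and A₊x = R(0)²x.
Conversely, for every y the Cauchy transform of the integrand extends R(l)A₊y to Re l < h, boundedly
on Re l ≤ 0 (`StripBounded.res_Aplus`), so ran A₊ ⊆ G₊. If moreover A₊x = R(0)²x, this extends
R(0)²R(l)x, and the Taylor identity then extends R(l)x itself with at most quadratic growth.
Boundedness on the imaginary axis and Phragmén–Lindelöf remove the growth.

For M₊ = G₊, the inclusion ⊆ follows from closedness. For ⊇, if x ∈ G₊ then R(l)²x = (1 + l R(l))²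
R(0)²x = A₊(1 + l R(l))²x lies in ran A₊, and (it)² R(it)²x → x by bisectoriality and density of the
domain. The same approximants lie in D(S) ∩ G₊, which gives its density. The minus case is the plus
case for -S. -/

theorem IsResolventAt.unique {S : X →ₗ.[ℂ] X} {l : ℂ} {R R' : X →L[ℂ] X}
    (h : IsResolventAt S l R) (h' : IsResolventAt S l R') : R = R' := by
  ext x
  obtain ⟨hx, e⟩ := h.1 x
  have := h'.2 ⟨R x, hx⟩
  rw [e] at this
  exact this.symm

theorem IsResolventAt.mem_rho {S : X →ₗ.[ℂ] X} {l : ℂ} {R : X →L[ℂ] X}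
    (h : IsResolventAt S l R) : l ∈ rho S := ⟨R, h⟩

theorem isResolventAt_res {S : X →ₗ.[ℂ] X} {l : ℂ} (h : l ∈ rho S) :
    IsResolventAt S l (res S l) := by
  have h' : ∃ R : X →L[ℂ] X, IsResolventAt S l R := h
  rw [res, dif_pos h']
  exact h'.choose_spec

theorem IsResolventAt.res_eq {S : X →ₗ.[ℂ] X} {l : ℂ} {R : X →L[ℂ] X}
    (h : IsResolventAt S l R) : res S l = R :=
  (isResolventAt_res h.mem_rho).unique h

theorem res_mem_domain {S : X →ₗ.[ℂ] X} {l : ℂ} (h : l ∈ rho S) (x : X) :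
    res S l x ∈ S.domain :=
  ((isResolventAt_res h).1 x).1

/-- The resolvent identity `(S - m)⁻¹ = (S - l)⁻¹ + (m - l) (S - l)⁻¹ (S - m)⁻¹`. -/
theorem res_apply_eq {S : X →ₗ.[ℂ] X} {l m : ℂ} (hl : l ∈ rho S) (hm : m ∈ rho S) (x : X) :
    res S m x = res S l x + (m - l) • res S l (res S m x) := by
  obtain ⟨hx, e⟩ := (isResolventAt_res hm).1 x
  have := (isResolventAt_res hl).2 ⟨res S m x, hx⟩
  have e' : S ⟨res S m x, hx⟩ - l • res S m x = x + (m - l) • res S m x := by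
    nth_rewrite 3 [← e]
    module
  simp only at this
  rw [e', map_add, map_smul] at this
  exact this.symm

theorem res_eq_add {S : X →ₗ.[ℂ] X} {l m : ℂ} (hl : l ∈ rho S) (hm : m ∈ rho S) :
    res S m = res S l + (m - l) • (res S l * res S m) := by
  ext x
  simpa using res_apply_eq hl hm x

/-- For l ≠ m both products equal the difference quotient of the resolvent, which is symmetric in l
and m. -/
theorem res_commute {S : X →ₗ.[ℂ] X} {l m : ℂ} (hl : l ∈ rho S) (hm : m ∈ rho S) (x : X) :
    res S l (res S m x) = res S m (res S l x) := by
  rcases eq_or_ne l m with rfl | hlm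
  · rfl
  have h1 := res_apply_eq hl hm x
  have h2 := res_apply_eq hm hl x
  have : (m - l) • res S l (res S m x) = (m - l) • res S m (res S l x) := by
    have h3 : (m - l) • res S l (res S m x) = res S m x - res S l x := by
      nth_rewrite 2 [h1]; abel
    have h4 : (l - m) • res S m (res S l x) = res S l x - res S m x := by
      nth_rewrite 2 [h2]; abel
    rw [h3, ← neg_sub l m, neg_smul, h4]; abel
  exact smul_right_injective X (sub_ne_zero.2 hlm.symm) this

/-- Neumann series: S - m = (1 - B)(S - l) with B = (m - l) R(l), and 1 - B is invertible and
commutes with R(l). -/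
theorem mem_rho_of_norm_lt [CompleteSpace X] {S : X →ₗ.[ℂ] X} {l m : ℂ} (hl : l ∈ rho S)
    (hm : ‖m - l‖ * ‖res S l‖ < 1) : m ∈ rho S := by
  set B : X →L[ℂ] X := (m - l) • res S l with hB
  have hB1 : ‖B‖ < 1 := by rwa [hB, norm_smul]
  set U : (X →L[ℂ] X)ˣ := Units.oneSub B hB1 with hU
  have hUv : (U : X →L[ℂ] X) = 1 - B := rfl
  have hcomm : Commute (res S l) (U : X →L[ℂ] X) := by
    rw [hUv, hB]
    exact (Commute.one_right _).sub_right ((Commute.refl _).smul_right _)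
  have hcomm' : res S l * (↑U⁻¹ : X →L[ℂ] X) = ↑U⁻¹ * res S l := hcomm.units_inv_right
  refine ⟨res S l * (↑U⁻¹ : X →L[ℂ] X), fun x => ?_, fun x => ?_⟩
  · obtain ⟨hx, e⟩ := (isResolventAt_res hl).1 ((↑U⁻¹ : X →L[ℂ] X) x)
    refine ⟨hx, ?_⟩
    have h1 : ((U : X →L[ℂ] X) * (↑U⁻¹ : X →L[ℂ] X)) x = x := by rw [U.mul_inv]; rfl
    rw [hUv] at h1
    simp only [mul_apply_eq_comp, sub_apply,
      one_apply_eq_self, hB, smul_apply] at h1 ⊢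
    refine Eq.trans ?_ h1
    nth_rewrite 4 [← e]
    module
  · rw [hcomm']
    have h1 : ((↑U⁻¹ : X →L[ℂ] X) * (U : X →L[ℂ] X)) (x : X) = x := by rw [U.inv_mul]; rfl
    rw [hUv] at h1
    simp only [mul_apply_eq_comp] at h1 ⊢
    refine Eq.trans ?_ h1
    congr 1
    have := (isResolventAt_res hl).2 x
    have e : S x - m • (x : X) = (S x - l • (x : X)) - (m - l) • (x : X) := by module
    rw [e, map_sub, this]
    simp [hB]

theorem isOpen_rho [CompleteSpace X] (S : X →ₗ.[ℂ] X) : IsOpen (rho S) := by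
  rw [isOpen_iff_mem_nhds]
  intro l hl
  have : Tendsto (fun m : ℂ => ‖m - l‖ * ‖res S l‖) (𝓝 l) (𝓝 (‖l - l‖ * ‖res S l‖)) :=
    (by fun_prop : Continuous fun m : ℂ => ‖m - l‖ * ‖res S l‖).tendsto l
  rw [sub_self, norm_zero, zero_mul] at this
  filter_upwards [this.eventually_lt_const one_pos] with m hm
  exact mem_rho_of_norm_lt hl hm

/-- By the resolvent identity ‖R(m)‖ ≤ ‖R(l)‖ + ‖R(m)‖ / 2, and the last term is absorbed on the
left. -/
theorem norm_res_le {S : X →ₗ.[ℂ] X} {l m : ℂ} (hl : l ∈ rho S) (hm : m ∈ rho S)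
    (h : ‖m - l‖ * ‖res S l‖ ≤ 1 / 2) : ‖res S m‖ ≤ 2 * ‖res S l‖ := by
  have h1 : ‖res S m‖ ≤ ‖res S l‖ + ‖m - l‖ * (‖res S l‖ * ‖res S m‖) := by
    calc ‖res S m‖ = ‖res S l + (m - l) • (res S l * res S m)‖ := by rw [← res_eq_add hl hm]
      _ ≤ ‖res S l‖ + ‖(m - l) • (res S l * res S m)‖ := norm_add_le _ _
      _ ≤ _ := by
        rw [norm_smul]
        gcongr
        exact norm_mul_le _ _
  nlinarith [norm_nonneg (res S m)]

theorem continuousOn_res [CompleteSpace X] (S : X →ₗ.[ℂ] X) : ContinuousOn (res S) (rho S) := by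
  intro l hl
  apply ContinuousAt.continuousWithinAt
  have hlim : Tendsto (fun m : ℂ => ‖m - l‖ * ‖res S l‖) (𝓝 l) (𝓝 0) := by
    have := (by fun_prop : Continuous fun m : ℂ => ‖m - l‖ * ‖res S l‖).tendsto l
    simpa using this
  have hlim2 : Tendsto (fun m : ℂ => ‖m - l‖ * (‖res S l‖ * (2 * ‖res S l‖))) (𝓝 l) (𝓝 0) := by
    have := (by fun_prop : Continuous
      fun m : ℂ => ‖m - l‖ * (‖res S l‖ * (2 * ‖res S l‖))).tendsto l
    simpa using this
  rw [ContinuousAt, tendsto_iff_norm_sub_tendsto_zero]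
  refine squeeze_zero' (Eventually.of_forall fun _ => norm_nonneg _) ?_ hlim2
  filter_upwards [hlim.eventually_lt_const (by norm_num : (0 : ℝ) < 1 / 2),
    (isOpen_rho S).mem_nhds hl] with m hm hm'
  rw [res_eq_add hl hm', add_sub_cancel_left, norm_smul]
  gcongr
  exact (norm_mul_le _ _).trans (by gcongr; exact norm_res_le hl hm' hm.le)

theorem differentiableOn_res [CompleteSpace X] (S : X →ₗ.[ℂ] X) :
    DifferentiableOn ℂ (res S) (rho S) := by
  intro l hl
  apply DifferentiableAt.differentiableWithinAt
  have hc : ContinuousAt (res S) l := (continuousOn_res S).continuousAt ((isOpen_rho S).mem_nhds hl)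
  have : HasDerivAt (res S) (res S l * res S l) l := by
    rw [hasDerivAt_iff_tendsto_slope]
    have h2 : Tendsto (fun m => res S l * res S m) (𝓝[≠] l) (𝓝 (res S l * res S l)) :=
      (continuousAt_const.mul hc).mono_left nhdsWithin_le_nhds
    refine h2.congr' ?_
    filter_upwards [nhdsWithin_le_nhds ((isOpen_rho S).mem_nhds hl), self_mem_nhdsWithin]
      with m hm hne
    rw [slope_def_module]
    nth_rewrite 2 [res_eq_add hl hm]
    rw [add_sub_cancel_left, smul_smul, inv_mul_cancel₀ (sub_ne_zero.2 hne), one_smul]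
  exact this.differentiableAt

/-- The resolvent of a bisectorial operator with `0 ∈ rho S` is bounded on a closed strip around the
imaginary axis. -/
theorem exists_stripBounded [CompleteSpace X] {S : X →ₗ.[ℂ] X} (hbis : IsBisectorial S)
    (h0 : (0 : ℂ) ∈ rho S) : ∃ h : ℝ, StripBounded S h := by
  obtain ⟨M, hM⟩ := hbis
  have hmem : ∀ t : ℝ, (t * I : ℂ) ∈ rho S := by
    intro t
    rcases eq_or_ne (t * I : ℂ) 0 with h | h
    · rwa [h]
    · exact (hM _ (by simp) h).1
  have hcont : ContinuousOn (fun t : ℝ => res S (t * I)) (Set.Icc (-1) 1) :=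
    (continuousOn_res S).comp (by fun_prop) fun t _ => hmem t
  obtain ⟨C, hC⟩ := isCompact_Icc.exists_bound_of_continuousOn hcont
  -- `C` bounds the resolvent for |t| ≤ 1 by compactness, |M| for |t| > 1 by bisectoriality; the 1
  -- keeps 1 / (2K) meaningful.
  set K := max 1 (max C |M|) with hK
  have hK1 : 1 ≤ K := le_max_left _ _
  have hbd : ∀ t : ℝ, ‖res S (t * I)‖ ≤ K := by
    intro t
    by_cases ht : |t| ≤ 1
    · exact (hC t (abs_le.1 ht)).trans ((le_max_left _ _).trans (le_max_right _ _))
    · push Not at ht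
      have hne : (t * I : ℂ) ≠ 0 := by
        have : t ≠ 0 := by rintro rfl; simp at ht; linarith
        simpa using this
      refine (hM _ (by simp) hne).2.trans (le_trans ?_ ((le_max_right _ _).trans (le_max_right _ _)))
      have : ‖(t * I : ℂ)‖ = |t| := by simp
      rw [this]
      calc M / |t| ≤ |M| / |t| := by gcongr; exact le_abs_self M
        _ ≤ |M| := div_le_self (abs_nonneg _) ht.le
  have key : ∀ l : ℂ, |l.re| ≤ 1 / (2 * K) → ‖l - l.im * I‖ * ‖res S (l.im * I)‖ ≤ 1 / 2 := by
    intro l hl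
    have e : l - l.im * I = (l.re : ℂ) := by
      apply Complex.ext <;> simp
    rw [e, Complex.norm_real, Real.norm_eq_abs]
    calc |l.re| * ‖res S (l.im * I)‖ ≤ 1 / (2 * K) * K := by gcongr; exact hbd _
      _ = 1 / 2 := by field_simp
  have hin : ∀ l : ℂ, |l.re| ≤ 1 / (2 * K) → l ∈ rho S := fun l hl =>
    mem_rho_of_norm_lt (hmem l.im) ((key l hl).trans_lt (by norm_num))
  refine ⟨1 / (2 * K), by positivity, hin, 2 * K, fun l hl => ?_⟩
  exact (norm_res_le (hmem l.im) (hin l hl) (key l hl)).trans (by gcongr; exact hbd _)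

end UnboundedOp

end

/-! ### Contour shifts and Phragmén–Lindelöf on half-planes -/

noncomputable section

namespace UnboundedOp

open Complex Filter Topology MeasureTheory

section HalfPlane

variable {E : Type*} [NormedAddCommGroup E] [NormedSpace ℂ E]

theorem sq_norm_add_mul_I (c t : ℝ) : ‖(c + t * I : ℂ)‖ ^ 2 = c ^ 2 + t ^ 2 := by
  rw [Complex.sq_norm, Complex.normSq_apply]
  simp
  ring

theorem add_mul_I_ne_zero {c : ℝ} (hc : c ≠ 0) (t : ℝ) : (c + t * I : ℂ) ≠ 0 := by
  intro h
  have := congrArg Complex.re h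
  simp at this
  exact hc this

theorem integrable_inv_sq_add_sq {c : ℝ} (hc : c ≠ 0) :
    Integrable fun t : ℝ => (c ^ 2 + t ^ 2)⁻¹ := by
  have hc2 : 0 < c ^ 2 := by positivity
  refine (integrable_inv_one_add_sq.const_mul (1 + (c ^ 2)⁻¹)).mono'
    (Continuous.aestronglyMeasurable ?_) (Eventually.of_forall fun t => ?_)
  · exact Continuous.inv₀ (by fun_prop) fun t => by positivity
  · rw [Real.norm_of_nonneg (by positivity), ← div_eq_mul_inv, inv_eq_one_div,
      div_le_div_iff₀ (by positivity) (by positivity)]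
    have : (1 + (c ^ 2)⁻¹) * (c ^ 2 + t ^ 2) = c ^ 2 + 1 + t ^ 2 + t ^ 2 * (c ^ 2)⁻¹ := by
      field_simp
      ring
    rw [this]
    have : 0 ≤ t ^ 2 * (c ^ 2)⁻¹ := by positivity
    linarith

theorem integral_inv_sq_add_sq {c : ℝ} (hc : 0 < c) :
    ∫ t : ℝ, 2 * c * (c ^ 2 + t ^ 2)⁻¹ = 2 * Real.pi := by
  have h1 : ∀ t : ℝ, 2 * c * (c ^ 2 + t ^ 2)⁻¹ = 2 / c * (1 + (t / c) ^ 2)⁻¹ := by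
    intro t
    field_simp
  simp_rw [h1]
  rw [integral_const_mul, Measure.integral_comp_div (fun s : ℝ => (1 + s ^ 2)⁻¹) c,
    integral_univ_inv_one_add_sq, abs_of_pos hc, smul_eq_mul]
  field_simp

/-- Quadratic decay of a continuous function along a vertical line gives integrability. -/
theorem integrable_of_norm_le_inv_sq {E : Type*} [NormedAddCommGroup E] {c : ℝ} (hc : c ≠ 0)
    {φ : ℝ → E} (hφ : Continuous φ) {K : ℝ} (hK : ∀ t, ‖φ t‖ ≤ K * (c ^ 2 + t ^ 2)⁻¹) : Integrable φ :=
  ((integrable_inv_sq_add_sq hc).const_mul K).mono' hφ.aestronglyMeasurable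
    (Eventually.of_forall hK)

/-- A function that is holomorphic on a closed left half-plane and decays quadratically there has
vanishing integral along the boundary line. -/
theorem integral_line_eq_zero_of_left [CompleteSpace E] {c : ℝ} (hc : c ≠ 0) {g : ℂ → E}
    (hg : DifferentiableOn ℂ g {z | z.re ≤ c}) {K : ℝ}
    (hK : ∀ z : ℂ, z.re ≤ c → ‖z‖ ^ 2 * ‖g z‖ ≤ K) : ∫ t : ℝ, g (c + t * I) = 0 := by
  have hcont : Continuous fun t : ℝ => g (c + t * I) :=
    hg.continuousOn.comp_continuous (by fun_prop) fun t => by simp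
  have hK0 : 0 ≤ K := le_trans (by positivity) (hK c (by simp))
  have hint : Integrable fun t : ℝ => g (c + t * I) := by
    refine integrable_of_norm_le_inv_sq hc hcont (K := K) fun t => ?_
    have := hK (c + t * I) (by simp)
    rw [sq_norm_add_mul_I] at this
    have hp : 0 < c ^ 2 + t ^ 2 := by positivity
    rw [← div_eq_mul_inv, le_div_iff₀ hp]
    linarith
  have hbound : ∀ T : ℝ, 0 < T → ∀ z : ℂ, z.re ≤ c → T / 2 ≤ ‖z‖ →
      ‖g z‖ ≤ 4 * K / T ^ 2 := by
    intro T hT z hz hzn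
    rw [le_div_iff₀ (by positivity)]
    have h1 := hK z hz
    have h2 : (T / 2) ^ 2 * ‖g z‖ ≤ ‖z‖ ^ 2 * ‖g z‖ := by gcongr
    nlinarith
  have hlim1 : Tendsto (fun T : ℝ => ∫ t in (-T)..T, g (c + t * I)) atTop
      (𝓝 (∫ t : ℝ, g (c + t * I))) :=
    intervalIntegral_tendsto_integral hint tendsto_neg_atTop_atBot tendsto_id
  have hlim2 : Tendsto (fun T : ℝ => ∫ t in (-T)..T, g (c + t * I)) atTop (𝓝 0) := by
    have hz : Tendsto (fun T : ℝ => 16 * K / T) atTop (𝓝 0) := tendsto_const_nhds.div_atTop tendsto_id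
    refine squeeze_zero_norm' ?_ hz
    filter_upwards [eventually_ge_atTop (2 * |c|), eventually_gt_atTop 0] with T hTc hT
    -- For T ≥ 2|c| the three sides off the line Re z = c stay at distance at least T / 2 from 0.
    -- Their lengths T, T, 2T and the bound 4K / T² on g add up to 16K / T.
    have hrect := Complex.integral_boundary_rect_eq_zero_of_differentiableOn g
      (⟨c - T, -T⟩ : ℂ) (⟨c, T⟩ : ℂ) (hg.mono ?_)
    · simp only at hrect
      set B : ℝ := 4 * K / T ^ 2 with hB
      have h1 : ‖∫ x : ℝ in (c - T)..c, g (x + ((-T : ℝ) : ℂ) * I)‖ ≤ B * |c - (c - T)| := by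
        refine intervalIntegral.norm_integral_le_of_norm_le_const fun x hx => ?_
        rw [Set.uIoc_of_le (by linarith)] at hx
        refine hbound T hT _ (by simpa using hx.2) ?_
        refine le_trans ?_ (Complex.abs_im_le_norm _)
        simp [abs_of_pos hT]
        linarith
      have h2 : ‖∫ x : ℝ in (c - T)..c, g (x + ((T : ℝ) : ℂ) * I)‖ ≤ B * |c - (c - T)| := by
        refine intervalIntegral.norm_integral_le_of_norm_le_const fun x hx => ?_
        rw [Set.uIoc_of_le (by linarith)] at hx
        refine hbound T hT _ (by simpa using hx.2) ?_
        refine le_trans ?_ (Complex.abs_im_le_norm _)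
        simp [abs_of_pos hT]
        linarith
      have h3 : ‖∫ y : ℝ in (-T)..T, g (((c - T : ℝ) : ℂ) + y * I)‖ ≤ B * |T - (-T)| := by
        refine intervalIntegral.norm_integral_le_of_norm_le_const fun y hy => ?_
        refine hbound T hT _ (by simpa using hT.le) ?_
        refine le_trans ?_ (Complex.abs_re_le_norm _)
        have hle := le_abs_self c
        have : |((((c - T : ℝ) : ℂ) + y * I)).re| = T - c := by
          simp only [add_re, ofReal_re, mul_re, I_re, mul_zero, ofReal_im, I_im, mul_one, sub_self,
            add_zero]
          rw [abs_sub_comm, abs_of_nonneg]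
          linarith [abs_nonneg c]
        rw [this]
        linarith
      rw [show |c - (c - T)| = T by rw [sub_sub_cancel, abs_of_pos hT]] at h1 h2
      rw [show |T - (-T)| = 2 * T by rw [sub_neg_eq_add, ← two_mul, abs_of_pos (by positivity)]] at h3
      have e : I • ∫ y : ℝ in (-T)..T, g (c + y * I) =
          (∫ x : ℝ in (c - T)..c, g (x + ((T : ℝ) : ℂ) * I)) -
          (∫ x : ℝ in (c - T)..c, g (x + ((-T : ℝ) : ℂ) * I)) +
          I • ∫ y : ℝ in (-T)..T, g (((c - T : ℝ) : ℂ) + y * I) := by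
        rw [← sub_eq_zero, ← hrect]
        abel
      have e2 : ‖∫ y : ℝ in (-T)..T, g (c + y * I)‖ = ‖I • ∫ y : ℝ in (-T)..T, g (c + y * I)‖ := by
        rw [norm_smul, Complex.norm_I, one_mul]
      rw [e2, e]
      refine (norm_add_le _ _).trans ?_
      rw [norm_smul, Complex.norm_I, one_mul]
      refine (add_le_add ((norm_sub_le _ _).trans (add_le_add h2 h1)) h3).trans (le_of_eq ?_)
      rw [hB]
      field_simp
      ring
    · intro z hz
      have := hz.1
      simp only [Set.mem_preimage, Set.uIcc_of_le (by linarith : c - T ≤ c)] at this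
      exact this.2
  exact tendsto_nhds_unique hlim1 hlim2

/-- The version of `integral_line_eq_zero_of_left` for right half-planes. -/
theorem integral_line_eq_zero_of_right [CompleteSpace E] {c : ℝ} (hc : c ≠ 0) {g : ℂ → E}
    (hg : DifferentiableOn ℂ g {z | c ≤ z.re}) {K : ℝ}
    (hK : ∀ z : ℂ, c ≤ z.re → ‖z‖ ^ 2 * ‖g z‖ ≤ K) : ∫ t : ℝ, g (c + t * I) = 0 := by
  have := integral_line_eq_zero_of_left (neg_ne_zero.2 hc) (g := fun z => g (-z))
    (hg.comp (by fun_prop) fun z (hz : z.re ≤ -c) => by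
      simp only [Set.mem_ofPred_eq, neg_re]; linarith) (K := K)
    fun z hz => by simpa using hK (-z) (by simp; linarith)
  rw [← this, ← integral_neg_eq_self]
  congr 1 with t
  congr 1
  push_cast
  ring

/-- A Phragmén–Lindelöf principle for functions of quadratic growth on the left half-plane. -/
theorem norm_le_of_quadratic_growth {f : ℂ → E} (hf : DifferentiableOn ℂ f {z | z.re ≤ 0})
    {A C : ℝ} (hA : ∀ z : ℂ, z.re ≤ 0 → ‖f z‖ ≤ A * (1 + ‖z‖) ^ 2)
    (hC : ∀ t : ℝ, ‖f (t * I)‖ ≤ C) {z : ℂ} (hz : z.re ≤ 0) : ‖f z‖ ≤ C := by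
  have hA0 : 0 ≤ A := by simpa using (norm_nonneg _).trans (hA 0 (by simp))
  -- The damping factor has |1 - εz| ≥ 1 and |1 - εz| ≥ ε|z| on Re z ≤ 0, so it cancels the
  -- quadratic growth without enlarging the boundary values; at the end ε → 0.
  have main : ∀ ε : ℝ, 0 < ε → ‖((1 - ε * z)⁻¹ ^ 2) • f z‖ ≤ C := by
    intro ε hε
    have hre : ∀ w : ℂ, 0 ≤ w.re → 1 ≤ (1 + ε * w).re := fun w hw => by
      simp
      positivity
    have hge1 : ∀ w : ℂ, 0 ≤ w.re → 1 ≤ ‖1 + ε * w‖ := fun w hw =>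
      (hre w hw).trans (Complex.re_le_norm _)
    have hge2 : ∀ w : ℂ, 0 ≤ w.re → ε * ‖w‖ ≤ ‖1 + ε * w‖ := fun w hw => by
      rw [← abs_of_pos hε, ← Real.norm_eq_abs, ← Complex.norm_real, ← norm_mul,
        ← abs_of_nonneg (norm_nonneg (_ * w)), ← abs_of_nonneg (norm_nonneg (_ + _)), ← sq_le_sq,
        Complex.sq_norm, Complex.sq_norm, Complex.normSq_apply, Complex.normSq_apply]
      have : 0 ≤ ε * w.re := by positivity
      simp [abs_of_pos hε]
      nlinarith
    have hne : ∀ w : ℂ, 0 ≤ w.re → 1 + ε * w ≠ 0 := fun w hw h => by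
      have := hge1 w hw
      rw [h, norm_zero] at this
      linarith
    set g : ℂ → E := fun w => ((1 + ε * w)⁻¹ ^ 2) • f (-w) with hgdef
    have hgd : DifferentiableOn ℂ g {w | 0 ≤ w.re} := by
      refine DifferentiableOn.smul (DifferentiableOn.pow (DifferentiableOn.inv (by fun_prop)
        fun w hw => hne w hw) 2) (hf.comp (by fun_prop) fun w hw => ?_)
      simpa using hw
    have hgb : ∀ w : ℂ, 0 ≤ w.re → ‖g w‖ ≤ A * (1 + ε⁻¹) ^ 2 := by
      intro w hw
      have h1 : 0 < ‖1 + ε * w‖ := lt_of_lt_of_le one_pos (hge1 w hw)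
      have h2 : 1 + ‖w‖ ≤ (1 + ε⁻¹) * ‖1 + ε * w‖ := by
        have : ‖w‖ ≤ ε⁻¹ * ‖1 + ε * w‖ := by
          rw [inv_mul_eq_div, le_div_iff₀ hε, mul_comm]
          exact hge2 w hw
        linarith [hge1 w hw]
      rw [hgdef, norm_smul, norm_pow, norm_inv]
      calc ‖1 + ε * w‖⁻¹ ^ 2 * ‖f (-w)‖
          ≤ ‖1 + ε * w‖⁻¹ ^ 2 * (A * ((1 + ε⁻¹) * ‖1 + ε * w‖) ^ 2) := by
            gcongr
            refine (hA (-w) (by simpa using hw)).trans ?_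
            rw [norm_neg]
            gcongr
        _ = A * (1 + ε⁻¹) ^ 2 := by field_simp
    have hz' : 0 ≤ (-z).re := by simpa using hz
    have hcl : closure {w : ℂ | 0 < w.re} ⊆ {w : ℂ | 0 ≤ w.re} :=
      closure_minimal (fun w (hw : 0 < w.re) => hw.le)
        (isClosed_le continuous_const Complex.continuous_re)
    have := PhragmenLindelof.right_half_plane_of_bounded_on_real (f := g) (C := C) (z := -z)
      (hgd.mono hcl).diffContOnCl ?_ ?_ ?_ hz'
    · simpa [hgdef, sub_eq_add_neg] using this
    · refine ⟨1, by norm_num, 0, ?_⟩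
      refine Asymptotics.IsBigO.of_bound (A * (1 + ε⁻¹) ^ 2) ?_
      rw [Filter.eventually_inf_principal]
      refine Eventually.of_forall fun w hw => ?_
      simpa using hgb w (le_of_lt hw)
    · refine ⟨A * (1 + ε⁻¹) ^ 2, ?_⟩
      rw [Filter.eventually_map]
      filter_upwards [eventually_ge_atTop (0 : ℝ)] with x hx
      exact hgb x (by simpa using hx)
    · intro t
      have h1 := hge1 (t * I) (by simp)
      rw [hgdef, norm_smul, norm_pow, norm_inv]
      have h2 : ‖f (-(t * I))‖ ≤ C := by simpa using hC (-t)
      have h3 : ‖1 + ε * (t * I)‖⁻¹ ^ 2 ≤ 1 := pow_le_one₀ (by positivity) (inv_le_one_of_one_le₀ h1)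
      calc _ ≤ 1 * ‖f (-(t * I))‖ := by gcongr
        _ ≤ C := by rwa [one_mul]
  have hlim : Tendsto (fun ε : ℝ => ‖((1 - ε * z)⁻¹ ^ 2) • f z‖) (𝓝[>] 0) (𝓝 ‖f z‖) := by
    have hc : ContinuousAt (fun ε : ℝ => ‖((1 - ε * z)⁻¹ ^ 2) • f z‖) 0 := by
      refine ((ContinuousAt.pow (ContinuousAt.inv₀ (by fun_prop) (by simp)) 2).smul
        continuousAt_const).norm
    have := hc.tendsto
    simp only [ofReal_zero, zero_mul, sub_zero, inv_one, one_pow, one_smul] at this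
    exact this.mono_left nhdsWithin_le_nhds
  exact le_of_tendsto hlim (by filter_upwards [self_mem_nhdsWithin] with ε hε using main ε hε)

end HalfPlane

end UnboundedOp

end

/-! ### The Cauchy transform on a vertical line -/

noncomputable section

namespace UnboundedOp

open Complex Filter Topology MeasureTheory

section CauchyTransform

variable {E : Type*} [NormedAddCommGroup E] [NormedSpace ℂ E]

/-- The Cauchy transform `l ↦ ∫ (c + i t - l)⁻¹ φ(t) dt` of a function on the line `Re = c`. -/
def cauchyTransform (c : ℝ) (φ : ℝ → E) (l : ℂ) : E :=
  ∫ t : ℝ, (c + t * I - l)⁻¹ • φ t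

theorem sub_re_le_norm_line_sub (c t : ℝ) (l : ℂ) : c - l.re ≤ ‖(c + t * I - l : ℂ)‖ := by
  refine le_trans (le_of_eq ?_) (Complex.re_le_norm _)
  simp

theorem line_sub_ne_zero {c : ℝ} {l : ℂ} (hl : l.re < c) (t : ℝ) : (c + t * I - l : ℂ) ≠ 0 := by
  rw [← norm_pos_iff]
  exact (sub_pos.2 hl).trans_le (sub_re_le_norm_line_sub c t l)

theorem norm_inv_line_sub_le {c : ℝ} {l : ℂ} (hl : l.re < c) (t : ℝ) :
    ‖(c + t * I - l : ℂ)⁻¹‖ ≤ (c - l.re)⁻¹ := by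
  rw [norm_inv]
  exact inv_anti₀ (sub_pos.2 hl) (sub_re_le_norm_line_sub c t l)

theorem continuous_inv_line_sub {c : ℝ} {l : ℂ} (hl : l.re < c) :
    Continuous fun t : ℝ => (c + t * I - l : ℂ)⁻¹ :=
  Continuous.inv₀ (by fun_prop) (line_sub_ne_zero hl)

theorem integrable_cauchyTransform {c : ℝ} {φ : ℝ → E} (hφ : Integrable φ) {l : ℂ}
    (hl : l.re < c) : Integrable fun t : ℝ => (c + t * I - l)⁻¹ • φ t :=
  hφ.bdd_smul (c - l.re)⁻¹ (continuous_inv_line_sub hl).aestronglyMeasurable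
    (Eventually.of_forall (norm_inv_line_sub_le hl))

theorem norm_cauchyTransform_le {c : ℝ} {φ : ℝ → E} (hφ : Integrable φ) {l : ℂ}
    (hl : l.re < c) : ‖cauchyTransform c φ l‖ ≤ (c - l.re)⁻¹ * ∫ t, ‖φ t‖ := by
  rw [← integral_const_mul]
  refine norm_integral_le_of_norm_le (hφ.norm.const_mul _) (Eventually.of_forall fun t => ?_)
  rw [norm_smul]
  gcongr
  exact norm_inv_line_sub_le hl t

theorem differentiableOn_cauchyTransform {c : ℝ} {φ : ℝ → E} (hφ : Integrable φ) :
    DifferentiableOn ℂ (cauchyTransform c φ) {l | l.re < c} := by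
  intro l hl
  apply DifferentiableAt.differentiableWithinAt
  have hl' : l.re < c := hl
  -- Half the distance to the line: the differentiated kernel is then at most d⁻² uniformly for w
  -- near l.
  set d : ℝ := (c - l.re) / 2 with hd
  have hd0 : 0 < d := by rw [hd]; linarith
  have hball : {w : ℂ | w.re < c - d} ∈ 𝓝 l :=
    (isOpen_lt Complex.continuous_re continuous_const).mem_nhds
      (by simp only [Set.mem_ofPred_eq]; rw [hd]; linarith)
  have hlt : ∀ w : ℂ, w.re < c - d → w.re < c := fun w hw => by linarith
  have := (hasDerivAt_integral_of_dominated_loc_of_deriv_le (μ := volume) (𝕜 := ℂ)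
    (F := fun w t => (c + t * I - w : ℂ)⁻¹ • φ t)
    (F' := fun w t => ((c + t * I - w : ℂ)⁻¹ ^ 2) • φ t)
    (bound := fun t => d⁻¹ ^ 2 * ‖φ t‖) hball ?_ (integrable_cauchyTransform hφ hl') ?_ ?_
    (hφ.norm.const_mul _) ?_).2
  · exact this.differentiableAt
  · filter_upwards [hball] with w hw
    exact (integrable_cauchyTransform hφ (hlt w hw)).aestronglyMeasurable
  · exact ((continuous_inv_line_sub hl').pow 2).aestronglyMeasurable.smul hφ.aestronglyMeasurable
  · refine Eventually.of_forall fun t w hw => ?_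
    have hw' : w.re < c - d := hw
    rw [norm_smul, norm_pow]
    gcongr
    refine (norm_inv_line_sub_le (hlt w hw) t).trans (inv_anti₀ hd0 ?_)
    linarith
  · refine Eventually.of_forall fun t w hw => ?_
    have h1 : HasDerivAt (fun w : ℂ => (c + t * I - w : ℂ)) (-1) w := by
      simpa using (hasDerivAt_id w).const_sub (c + t * I : ℂ)
    have h2 := (h1.fun_inv (line_sub_ne_zero (hlt w hw) t)).smul_const (φ t)
    convert h2 using 2
    rw [neg_neg, one_div, inv_pow]

end CauchyTransform

/-! ### Convergence of A₊ and its range inside G₊ -/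

variable {X : Type*} [NormedAddCommGroup X] [NormedSpace ℂ X]
  {S : X →ₗ.[ℂ] X} {h : ℝ}

theorem StripBounded.line_mem_rho (hS : StripBounded S h) {c : ℝ} (hc : |c| ≤ h) (t : ℝ) :
    (c + t * I : ℂ) ∈ rho S :=
  hS.2.1 _ (by simpa using hc)

theorem StripBounded.zero_mem_rho (hS : StripBounded S h) : (0 : ℂ) ∈ rho S :=
  hS.2.1 _ (by simpa using hS.1.le)

theorem StripBounded.abs_self_le (hS : StripBounded S h) : |h| ≤ h :=
  (abs_of_pos hS.1).le

theorem Aplus_eq (S : X →ₗ.[ℂ] X) (h : ℝ) :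
    Aplus S h = (1 / (2 * Real.pi) : ℂ) • ∫ t : ℝ, integrand S (h + t * I) := by
  rw [Aplus, lineIntegral, smul_smul]
  congr 1
  have := I_ne_zero
  field_simp

variable [CompleteSpace X]

theorem StripBounded.integrable_integrand (hS : StripBounded S h) {c : ℝ} (hc0 : c ≠ 0)
    (hc : |c| ≤ h) : Integrable fun t : ℝ => integrand S (c + t * I) := by
  obtain ⟨M, hM⟩ := hS.2.2
  refine integrable_of_norm_le_inv_sq hc0 (K := M) ?_ fun t => ?_
  · have h1 : Continuous fun t : ℝ => 1 / (c + t * I : ℂ) ^ 2 :=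
      continuous_const.div (by fun_prop) fun t => pow_ne_zero _ (add_mul_I_ne_zero hc0 t)
    have h2 : Continuous fun t : ℝ => res S (c + t * I) :=
      (continuousOn_res S).comp_continuous (by fun_prop) (hS.line_mem_rho hc)
    exact h1.smul h2
  · rw [integrand, norm_smul, norm_div, norm_one, norm_pow, sq_norm_add_mul_I, one_div, mul_comm]
    gcongr
    exact hM _ (by simpa using hc)

theorem StripBounded.Aplus_apply (hS : StripBounded S h) (x : X) :
    Aplus S h x = (1 / (2 * Real.pi) : ℂ) • ∫ t : ℝ, integrand S (h + t * I) x := by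
  rw [Aplus_eq, smul_apply,
    ContinuousLinearMap.integral_apply (hS.integrable_integrand hS.1.ne' hS.abs_self_le)]

theorem StripBounded.integrable_integrand_apply (hS : StripBounded S h) (x : X) :
    Integrable fun t : ℝ => integrand S (h + t * I) x :=
  (ContinuousLinearMap.apply ℂ X x).integrable_comp
    (hS.integrable_integrand hS.1.ne' hS.abs_self_le)

theorem StripBounded.Aplus_res (hS : StripBounded S h) {l : ℂ} (hl : l ∈ rho S) (x : X) :
    Aplus S h (res S l x) = res S l (Aplus S h x) := by
  rw [hS.Aplus_apply, hS.Aplus_apply, map_smul,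
    ← ContinuousLinearMap.integral_comp_comm _ (hS.integrable_integrand_apply x)]
  congr 2 with t
  simp only [integrand, smul_apply, map_smul]
  rw [res_commute hl (hS.line_mem_rho hS.abs_self_le t)]

/-- A holomorphic extension of the resolvent orbit to `Re < h`, bounded on the closed left
half-plane, can be glued with the resolvent orbit on `rho S`. -/
theorem mem_Gplus_of_differentiableOn (hh : 0 < h) {x : X} {F : ℂ → X}
    (hF : DifferentiableOn ℂ F {l | l.re < h})
    (hFx : ∀ l ∈ rho S, l.re < h → F l = res S l x) {C : ℝ}
    (hC : ∀ l : ℂ, l.re ≤ 0 → ‖F l‖ ≤ C) : x ∈ Gplus S := by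
  classical
  have hopen : IsOpen {l : ℂ | l.re < h} := isOpen_lt Complex.continuous_re continuous_const
  have hres : DifferentiableOn ℂ (fun l => res S l x) (rho S) := fun l hl =>
    (differentiableOn_res S l hl).clm_apply (differentiableWithinAt_const x)
  refine ⟨fun l => if l.re < h then F l else res S l x, ?_, ?_, C, ?_⟩
  · rintro l (hl | hl)
    · have hl' : l.re < h := lt_of_le_of_lt hl hh
      refine (hF.analyticAt (hopen.mem_nhds hl')).congr ?_
      filter_upwards [hopen.mem_nhds hl'] with m hm
      have hm' : m.re < h := hm
      rw [if_pos hm']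
    · refine (hres.analyticAt ((isOpen_rho S).mem_nhds hl)).congr ?_
      filter_upwards [(isOpen_rho S).mem_nhds hl] with m hm
      split_ifs with hmh
      · exact (hFx m hm hmh).symm
      · rfl
  · intro l hl
    simp only
    split_ifs with hlh
    · exact hFx l hl hlh
    · rfl
  · intro l hl
    have hl' : l.re < h := lt_of_le_of_lt hl hh
    simp only [if_pos hl']
    exact hC l hl

theorem integrable_inv_sq_line {c : ℝ} (hc : c ≠ 0) :
    Integrable fun t : ℝ => ((c + t * I : ℂ) ^ 2)⁻¹ := by
  refine integrable_of_norm_le_inv_sq hc (K := 1) ?_ fun t => ?_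
  · exact Continuous.inv₀ (by fun_prop) fun t => pow_ne_zero _ (add_mul_I_ne_zero hc t)
  · rw [norm_inv, norm_pow, sq_norm_add_mul_I, one_mul]

/-- Both poles 0 and l lie to the left of the line, so the contour is closed to the right. -/
theorem integral_inv_sq_mul_inv_line_sub {c : ℝ} (hc : 0 < c) {l : ℂ} (hl : l.re < c) :
    ∫ t : ℝ, ((c + t * I : ℂ) ^ 2)⁻¹ * (c + t * I - l)⁻¹ = 0 := by
  have hd : 0 < c - l.re := sub_pos.2 hl
  have hle : ∀ z : ℂ, c ≤ z.re → c - l.re ≤ ‖z - l‖ := fun z hz =>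
    le_trans (by rw [sub_re]; linarith) (Complex.re_le_norm _)
  have hz0 : ∀ z : ℂ, c ≤ z.re → z ≠ 0 := by
    rintro z hz rfl
    simp at hz
    linarith
  refine integral_line_eq_zero_of_right hc.ne' (g := fun z => (z ^ 2)⁻¹ * (z - l)⁻¹)
    (K := (c - l.re)⁻¹) ?_ fun z hz => ?_
  · refine DifferentiableOn.mul (DifferentiableOn.inv (by fun_prop) fun z hz => ?_)
      (DifferentiableOn.inv (by fun_prop) fun z hz => ?_)
    · exact pow_ne_zero _ (hz0 z hz)
    · exact norm_pos_iff.1 (hd.trans_le (hle z hz))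
  · have := norm_pos_iff.2 (hz0 z hz)
    rw [norm_mul, norm_inv, norm_inv, norm_pow, mul_inv_cancel_left₀ (by positivity)]
    exact inv_anti₀ hd (hle z hz)

theorem integral_inv_sq_line {c : ℝ} (hc : 0 < c) : ∫ t : ℝ, ((c + t * I : ℂ) ^ 2)⁻¹ = 0 := by
  have hz0 : ∀ z : ℂ, c ≤ z.re → z ≠ 0 := by
    rintro z hz rfl
    simp at hz
    linarith
  refine integral_line_eq_zero_of_right hc.ne' (g := fun z => (z ^ 2)⁻¹)
    (K := 1) ?_ fun z hz => ?_
  · exact DifferentiableOn.inv (by fun_prop) fun z hz => pow_ne_zero _ (hz0 z hz)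
  · have := norm_pos_iff.2 (hz0 z hz)
    rw [norm_inv, norm_pow, mul_inv_cancel₀ (by positivity)]

/-- The Cauchy transform of the integrand extends the resolvent orbit of `A₊ y`. -/
theorem StripBounded.res_Aplus (hS : StripBounded S h) {l : ℂ} (hl : l ∈ rho S) (hlh : l.re < h)
    (y : X) : res S l (Aplus S h y) =
      (1 / (2 * Real.pi) : ℂ) • cauchyTransform h (fun t => integrand S (h + t * I) y) l := by
  have hint := hS.integrable_integrand_apply y
  rw [hS.Aplus_apply, map_smul, ← ContinuousLinearMap.integral_comp_comm _ hint]
  congr 1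
  -- The resolvent identity splits the product; the second term is a scalar kernel times a fixed
  -- vector, and its integral vanishes.
  have hpt : ∀ t : ℝ, res S l (integrand S (h + t * I) y) =
      (h + t * I - l)⁻¹ • integrand S (h + t * I) y -
        (((h + t * I : ℂ) ^ 2)⁻¹ * (h + t * I - l)⁻¹) • res S l y := by
    intro t
    have hne := line_sub_ne_zero hlh t
    simp only [integrand, smul_apply, map_smul, one_div]
    have := res_apply_eq hl (hS.line_mem_rho hS.abs_self_le t) y
    have h2 : res S l (res S (h + t * I) y) =
        (h + t * I - l)⁻¹ • (res S (h + t * I) y - res S l y) := by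
      nth_rewrite 2 [this]
      rw [add_sub_cancel_left, smul_smul, inv_mul_cancel₀ hne, one_smul]
    rw [h2]
    module
  have hint1 := integrable_cauchyTransform hint hlh
  have hint2 : Integrable fun t : ℝ => ((h + t * I : ℂ) ^ 2)⁻¹ * (h + t * I - l)⁻¹ := by
    have := integrable_cauchyTransform (integrable_inv_sq_line hS.1.ne') hlh
    simpa [mul_comm] using this
  simp_rw [hpt]
  rw [integral_sub hint1 (hint2.smul_const _), integral_smul_const,
    integral_inv_sq_mul_inv_line_sub hS.1 hlh, zero_smul, sub_zero, cauchyTransform]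

theorem StripBounded.Aplus_mem_Gplus (hS : StripBounded S h) (y : X) :
    Aplus S h y ∈ Gplus S := by
  have hint := hS.integrable_integrand_apply y
  refine mem_Gplus_of_differentiableOn hS.1
    ((differentiableOn_cauchyTransform hint).const_smul (1 / (2 * Real.pi) : ℂ))
    (fun l hl hlh => (hS.res_Aplus hl hlh y).symm)
    (C := ‖(1 / (2 * Real.pi) : ℂ)‖ * (h⁻¹ * ∫ t : ℝ, ‖integrand S (h + t * I) y‖))
    fun l hl => ?_
  rw [Pi.smul_apply, norm_smul]
  gcongr
  refine (norm_cauchyTransform_le hint (hl.trans_lt hS.1)).trans ?_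
  have h1 := hS.1
  gcongr
  linarith

end UnboundedOp

end

/-! ### G₊ as the kernel of A₊ - R(0)² -/

noncomputable section

namespace UnboundedOp

open Complex Filter Topology MeasureTheory

variable {X : Type*} [NormedAddCommGroup X] [NormedSpace ℂ X] {S : X →ₗ.[ℂ] X} {h : ℝ}

/-- The resolvent identity at 0, inserted into itself once. -/
theorem res_apply_eq_taylor {l : ℂ} (h0 : (0 : ℂ) ∈ rho S) (hl : l ∈ rho S) (x : X) :
    res S l x = res S 0 x + l • res S 0 (res S 0 x) + l ^ 2 • res S 0 (res S 0 (res S l x)) := by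
  have h1 := res_apply_eq h0 hl x
  rw [sub_zero] at h1
  nth_rewrite 1 [h1]
  nth_rewrite 1 [h1]
  rw [map_add, map_smul]
  module

/-- An analytic extension of a resolvent orbit satisfies the second-order Taylor identity on
`Re ≤ h`. -/
theorem extension_eq_taylor [CompleteSpace X] (hS : StripBounded S h) {x : X} {f : ℂ → X}
    (hf : AnalyticOnNhd ℂ f {l | l.re ≤ h}) (hfx : ∀ l ∈ rho S, f l = res S l x) {l : ℂ}
    (hl : l.re ≤ h) :
    f l = res S 0 x + l • res S 0 (res S 0 x) + l ^ 2 • res S 0 (res S 0 (f l)) := by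
  have h0 := hS.zero_mem_rho
  have hg : AnalyticOnNhd ℂ (fun l => res S 0 x + l • res S 0 (res S 0 x) +
      l ^ 2 • res S 0 (res S 0 (f l))) {l | l.re ≤ h} := by
    intro m hm
    have h1 : AnalyticAt ℂ (fun l => res S 0 (res S 0 (f l))) m :=
      ((res S 0).analyticAt _).fun_comp (((res S 0).analyticAt _).fun_comp (hf m hm))
    exact (analyticAt_const.add (analyticAt_id.smul analyticAt_const)).add
      ((analyticAt_id.pow 2).smul h1)
  -- Near 0 ∈ `rho S` the extension is the resolvent orbit; the identity theorem carries the
  -- relation to the whole half-plane.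
  refine hf.eqOn_of_preconnected_of_eventuallyEq hg
    (convex_halfSpace_re_le h).isPreconnected (z₀ := 0) (by simpa using hS.1.le) ?_ hl
  filter_upwards [(isOpen_rho S).mem_nhds h0] with m hm
  rw [hfx m hm]
  exact res_apply_eq_taylor h0 hm x

theorem StripBounded.Aplus_eq_of_mem_Gplus [CompleteSpace X] (hS : StripBounded S h) {x : X}
    (hx : x ∈ Gplus S) : Aplus S h x = res S 0 (res S 0 x) := by
  obtain ⟨f, hf, hfx, C, hC⟩ := hx
  obtain ⟨M, hM⟩ := hS.2.2
  have hh := hS.1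
  have hsub : {l : ℂ | l.re ≤ h} ⊆ {l : ℂ | l.re ≤ 0} ∪ rho S := by
    intro l (hl : l.re ≤ h)
    by_cases hl0 : l.re ≤ 0
    · exact Or.inl hl0
    · exact Or.inr (hS.2.1 l (by rwa [abs_of_pos (not_le.1 hl0)]))
  have hfU : AnalyticOnNhd ℂ f {l | l.re ≤ h} := hf.mono hsub
  have hfb : ∀ l : ℂ, l.re ≤ h → ‖f l‖ ≤ max C (M * ‖x‖) := by
    intro l hl
    by_cases hl0 : l.re ≤ 0
    · exact (hC l hl0).trans (le_max_left _ _)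
    · have habs : |l.re| ≤ h := by rwa [abs_of_pos (not_le.1 hl0)]
      rw [hfx l (hS.2.1 l habs)]
      refine le_trans ?_ (le_max_right _ _)
      exact (ContinuousLinearMap.le_opNorm _ _).trans (by gcongr; exact hM l habs)
  set r := res S 0 (res S 0 x) with hr
  -- The term (2h - z)⁻¹ x, with its pole to the right of the line, cancels the linear growth of z²
  -- R(0)² f(z). Thus z² g(z) is bounded and g integrates to 0, which replaces a residue computation
  -- at 0.
  set g : ℂ → X := fun z => res S 0 (res S 0 (f z - (2 * h - z)⁻¹ • x)) with hg
  have hne : ∀ z : ℂ, z.re ≤ h → (2 * h - z : ℂ) ≠ 0 := by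
    intro z hz hz0
    have := congrArg Complex.re hz0
    simp at this
    linarith
  have hzg : ∀ z : ℂ, z.re ≤ h →
      z ^ 2 • g z = f z - res S 0 x - (2 * h * (z / (2 * h - z))) • r := by
    intro z hz
    have h1 := extension_eq_taylor hS hfU hfx hz
    have h2 : z ^ 2 • res S 0 (res S 0 (f z)) = f z - res S 0 x - z • r := by
      nth_rewrite 2 [h1]
      rw [hr]
      abel
    have h3 : z ^ 2 * (2 * h - z)⁻¹ + z = 2 * h * (z / (2 * h - z)) := by
      have := hne z hz
      field_simp
      ring
    simp only [hg, map_sub, map_smul]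
    rw [smul_sub, h2, ← h3, ← hr]
    module
  have hgd : DifferentiableOn ℂ g {z | z.re ≤ h} := by
    refine (res S 0).differentiable.comp_differentiableOn
      ((res S 0).differentiable.comp_differentiableOn (hfU.differentiableOn.sub ?_))
    exact (DifferentiableOn.inv (by fun_prop) fun z hz => hne z hz).smul_const x
  have hgK : ∀ z : ℂ, z.re ≤ h →
      ‖z‖ ^ 2 * ‖g z‖ ≤ max C (M * ‖x‖) + ‖res S 0 x‖ + 2 * h * 1 * ‖r‖ := by
    intro z hz
    rw [← norm_pow, ← norm_smul, hzg z hz]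
    refine (norm_sub_le _ _).trans (add_le_add ((norm_sub_le _ _).trans
      (add_le_add (hfb z hz) le_rfl)) ?_)
    rw [norm_smul, norm_mul, norm_mul, Complex.norm_ofNat, Complex.norm_real, Real.norm_eq_abs,
      abs_of_pos hh, norm_div]
    gcongr
    refine div_le_one_of_le₀ ?_ (norm_nonneg _)
    -- For Re z ≤ h the point z is at least as close to 0 as to 2h.
    rw [← abs_of_nonneg (norm_nonneg z), ← abs_of_nonneg (norm_nonneg (_ - _)), ← sq_le_sq,
      Complex.sq_norm, Complex.sq_norm, Complex.normSq_apply, Complex.normSq_apply]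
    simp
    nlinarith
  have hg0 : ∫ t : ℝ, g (h + t * I) = 0 := integral_line_eq_zero_of_left hh.ne' hgd hgK
  have hgi : Integrable fun t : ℝ => g (h + t * I) := by
    refine integrable_of_norm_le_inv_sq hh.ne'
      (hgd.continuousOn.comp_continuous (by fun_prop) fun t => by simp)
      (K := max C (M * ‖x‖) + ‖res S 0 x‖ + 2 * h * 1 * ‖r‖) fun t => ?_
    have := hgK (h + t * I) (by simp)
    rw [sq_norm_add_mul_I] at this
    rw [← div_eq_mul_inv, le_div_iff₀ (by positivity)]
    linarith
  have hi1 := integrable_inv_sq_line hh.ne'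
  have hi2 : Integrable fun t : ℝ => ((2 * h * (h ^ 2 + t ^ 2)⁻¹ : ℝ) : ℂ) :=
    ((integrable_inv_sq_add_sq hh.ne').const_mul (2 * h)).ofReal
  have hpt : ∀ t : ℝ, integrand S (h + t * I) x = g (h + t * I) +
      ((h + t * I : ℂ) ^ 2)⁻¹ • res S 0 x + ((2 * h * (h ^ 2 + t ^ 2)⁻¹ : ℝ) : ℂ) • r := by
    intro t
    have hz := hzg (h + t * I) (by simp)
    have hz0 := add_mul_I_ne_zero hh.ne' t
    have hmem := hS.line_mem_rho hS.abs_self_le t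
    have hz2 := hne (h + t * I) (by simp)
    rw [hfx _ hmem] at hz
    have e : res S (h + t * I) x = (h + t * I : ℂ) ^ 2 • g (h + t * I) + res S 0 x +
        (2 * h * ((h + t * I : ℂ) / (2 * h - (h + t * I)))) • r := by
      rw [hz]; abel
    -- On the line Re z = h the number 2h - z is the conjugate of z, so z (2h - z) = h² + t²; this
    -- Poisson kernel has total mass 2π.
    have e2 : ((2 * h * (h ^ 2 + t ^ 2)⁻¹ : ℝ) : ℂ) =
        ((h + t * I : ℂ) ^ 2)⁻¹ * (2 * h * ((h + t * I : ℂ) / (2 * h - (h + t * I)))) := by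
      have e3 : ((h ^ 2 + t ^ 2 : ℝ) : ℂ) = (h + t * I) * (2 * h - (h + t * I)) := by
        push_cast
        linear_combination t ^ 2 * I_sq
      rw [ofReal_mul, ofReal_inv, e3]
      push_cast
      field_simp
    rw [integrand, smul_apply, e, one_div, smul_add, smul_add, smul_smul, smul_smul,
      inv_mul_cancel₀ (pow_ne_zero 2 hz0), one_smul, e2]
  rw [hS.Aplus_apply]
  simp_rw [hpt]
  have hgi1 : Integrable fun t : ℝ => g (h + t * I) + ((h + t * I : ℂ) ^ 2)⁻¹ • res S 0 x :=
    hgi.add (hi1.smul_const _)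
  rw [integral_add hgi1 (hi2.smul_const _),
    integral_add hgi (hi1.smul_const _), integral_smul_const, integral_smul_const, hg0,
    integral_inv_sq_line hh, zero_smul, zero_add, zero_add, integral_complex_ofReal,
    integral_inv_sq_add_sq hh, smul_smul]
  have hpi : (Real.pi : ℂ) ≠ 0 := by exact_mod_cast Real.pi_ne_zero
  have : (1 / (2 * Real.pi) : ℂ) * ((2 * Real.pi : ℝ) : ℂ) = 1 := by
    push_cast
    field_simp
  rw [this, one_smul]

theorem StripBounded.mem_Gplus_of_Aplus_eq [CompleteSpace X] (hS : StripBounded S h) {x : X}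
    (hx : Aplus S h x = res S 0 (res S 0 x)) : x ∈ Gplus S := by
  have h0 := hS.zero_mem_rho
  have hh := hS.1
  have hint := hS.integrable_integrand_apply x
  obtain ⟨M, hM⟩ := hS.2.2
  set Ψ : ℂ → X := fun l =>
    (1 / (2 * Real.pi) : ℂ) • cauchyTransform h (fun t => integrand S (h + t * I) x) l with hΨ
  have hΨd : DifferentiableOn ℂ Ψ {l | l.re < h} :=
    (differentiableOn_cauchyTransform hint).const_smul _
  obtain ⟨B, hB⟩ : ∃ B : ℝ, ∀ l : ℂ, l.re ≤ 0 → ‖Ψ l‖ ≤ B := by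
    refine ⟨‖(1 / (2 * Real.pi) : ℂ)‖ * (h⁻¹ * ∫ t : ℝ, ‖integrand S (h + t * I) x‖),
      fun l hl => ?_⟩
    rw [hΨ, norm_smul]
    gcongr
    refine (norm_cauchyTransform_le hint (hl.trans_lt hh)).trans ?_
    gcongr
    linarith
  have hB0 : 0 ≤ B := (norm_nonneg _).trans (hB 0 (by simp))
  -- The right side of the Taylor identity with `Ψ` in place of R(0)²R(l)x; the hypothesis on x
  -- makes the two agree on `rho S` to the left of the line.
  set F : ℂ → X := fun l => res S 0 x + l • res S 0 (res S 0 x) + l ^ 2 • Ψ l with hF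
  have hFd : DifferentiableOn ℂ F {l | l.re < h} :=
    ((differentiableOn_const _).add (differentiableOn_id.smul_const _)).add
      ((differentiableOn_id.pow 2).smul hΨd)
  have hFx : ∀ l ∈ rho S, l.re < h → F l = res S l x := by
    intro l hl hlh
    simp only [hF, hΨ]
    rw [res_apply_eq_taylor h0 hl x, res_commute h0 hl, res_commute h0 hl, ← hx,
      hS.res_Aplus hl hlh]
  refine mem_Gplus_of_differentiableOn hh hFd hFx (C := M * ‖x‖) fun l hl => ?_
  refine norm_le_of_quadratic_growth (hFd.mono fun z (hz : z.re ≤ 0) => hz.trans_lt hh)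
    (A := ‖res S 0 x‖ + ‖res S 0 (res S 0 x)‖ + B) (fun z hz => ?_) (fun t => ?_) hl
  · have h1 : ‖F z‖ ≤ ‖res S 0 x‖ + ‖z‖ * ‖res S 0 (res S 0 x)‖ + ‖z‖ ^ 2 * B := by
      refine (norm_add_le _ _).trans (add_le_add ((norm_add_le _ _).trans
        (add_le_add le_rfl (norm_smul_le _ _))) ?_)
      rw [norm_smul, norm_pow]
      gcongr
      exact hB z hz
    refine h1.trans ?_
    have ha : ‖res S 0 x‖ ≤ ‖res S 0 x‖ * (1 + ‖z‖) ^ 2 :=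
      le_mul_of_one_le_right (norm_nonneg _) (by nlinarith [norm_nonneg z])
    have hb : ‖z‖ * ‖res S 0 (res S 0 x)‖ ≤ ‖res S 0 (res S 0 x)‖ * (1 + ‖z‖) ^ 2 := by
      rw [mul_comm]
      gcongr
      nlinarith [norm_nonneg z]
    have hc : ‖z‖ ^ 2 * B ≤ B * (1 + ‖z‖) ^ 2 := by
      rw [mul_comm]
      gcongr
      linarith
    linarith
  · have hmem : |(t * I : ℂ).re| ≤ h := by simpa using hh.le
    rw [hFx _ (hS.2.1 _ hmem) (by simpa using hh)]
    exact (ContinuousLinearMap.le_opNorm _ _).trans (by gcongr; exact hM _ hmem)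

theorem StripBounded.mem_Gplus_iff [CompleteSpace X] (hS : StripBounded S h) {x : X} :
    x ∈ Gplus S ↔ Aplus S h x = res S 0 (res S 0 x) :=
  ⟨hS.Aplus_eq_of_mem_Gplus, hS.mem_Gplus_of_Aplus_eq⟩

theorem StripBounded.isClosed_Gplus [CompleteSpace X] (hS : StripBounded S h) :
    IsClosed (Gplus S : Set X) := by
  have : (Gplus S : Set X) = {x | Aplus S h x = res S 0 (res S 0 x)} := by
    ext x
    exact hS.mem_Gplus_iff
  rw [this]
  exact isClosed_eq (by fun_prop) (by fun_prop)

/-! ### Strong approximation of the identity, density and M₊ = G₊ -/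

/-- The rescaled resolvents `-i t (S - i t)⁻¹` of a densely defined bisectorial operator converge
strongly to the identity. -/
theorem tendsto_smul_res (hdense : IsDenselyDefined S) (hbis : IsBisectorial S) (x : X) :
    Tendsto (fun t : ℝ => (-(t * I : ℂ)) • res S (t * I) x) atTop (𝓝 x) := by
  obtain ⟨M, hM⟩ := hbis
  have hne : ∀ t : ℝ, 0 < t → (t * I : ℂ) ≠ 0 := fun t ht => by simpa using ht.ne'
  have hnorm : ∀ t : ℝ, 0 < t → ‖(t * I : ℂ)‖ = t := fun t ht => by simp [abs_of_pos ht]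
  have hres : ∀ t : ℝ, 0 < t → ∀ y : X, ‖res S (t * I) y‖ ≤ M / t * ‖y‖ := fun t ht y => by
    have := (hM (t * I) (by simp) (hne t ht)).2
    rw [hnorm t ht] at this
    exact (ContinuousLinearMap.le_opNorm _ _).trans (by gcongr)
  have hM0 : 0 ≤ M := by
    have := (norm_nonneg _).trans (hM (1 * I) (by simp) (by simp)).2
    simpa using this
  have hop : ∀ t : ℝ, 0 < t → ∀ y : X, ‖(-(t * I : ℂ)) • res S (t * I) y‖ ≤ M * ‖y‖ := by
    intro t ht y
    rw [norm_smul, norm_neg, hnorm t ht]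
    calc t * ‖res S (t * I) y‖ ≤ t * (M / t * ‖y‖) := by gcongr; exact hres t ht y
      _ = M * ‖y‖ := by field_simp
  have hdom : ∀ y : S.domain,
      Tendsto (fun t : ℝ => (-(t * I : ℂ)) • res S (t * I) (y : X)) atTop (𝓝 (y : X)) := by
    intro y
    rw [tendsto_iff_norm_sub_tendsto_zero]
    have hz : Tendsto (fun t : ℝ => M * ‖S y‖ / t) atTop (𝓝 0) :=
      tendsto_const_nhds.div_atTop tendsto_id
    refine squeeze_zero' (Eventually.of_forall fun _ => norm_nonneg _) ?_ hz
    filter_upwards [eventually_gt_atTop (0 : ℝ)] with t ht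
    have h1 := (isResolventAt_res (hM (t * I) (by simp) (hne t ht)).1).2 y
    have h2 : (-(t * I : ℂ)) • res S (t * I) (y : X) - y = - res S (t * I) (S y) := by
      nth_rewrite 2 [← h1]
      rw [map_sub, map_smul]
      module
    rw [h2, norm_neg]
    refine (hres t ht _).trans (le_of_eq ?_)
    ring
  rw [Metric.tendsto_atTop]
  intro ε hε
  -- The rescaled resolvents have norm at most M and the identity has norm at most 1, so replacing x
  -- by y costs at most (M + 1)‖x - y‖ < ε / 2.
  have hδ : 0 < ε / (2 * (M + 1)) := by positivity
  obtain ⟨y, hy, hxy⟩ := Metric.dense_iff.1 hdense x _ hδ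
  have hxy' : ‖x - y‖ < ε / (2 * (M + 1)) := by
    rw [← dist_eq_norm, dist_comm]
    exact hy
  obtain ⟨N, hN⟩ := Metric.tendsto_atTop.1 (hdom ⟨y, hxy⟩) (ε / 2) (by positivity)
  refine ⟨max N 1, fun t ht => ?_⟩
  have ht0 : 0 < t := by linarith [le_max_right N 1]
  have hNt := hN t ((le_max_left _ _).trans ht)
  rw [dist_eq_norm] at hNt ⊢
  have e : (-(t * I : ℂ)) • res S (t * I) x - x =
      (-(t * I : ℂ)) • res S (t * I) (x - y) + ((-(t * I : ℂ)) • res S (t * I) y - y) -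
        (x - y) := by
    rw [map_sub]
    module
  rw [e]
  have h1 := hop t ht0 (x - y)
  have h2 : (M + 1) * ‖x - y‖ < ε / 2 := by
    rw [lt_div_iff₀ (by positivity)] at hxy'
    linarith
  calc _ ≤ ‖(-(t * I : ℂ)) • res S (t * I) (x - y)‖ +
        ‖(-(t * I : ℂ)) • res S (t * I) y - y‖ + ‖x - y‖ :=
        (norm_sub_le _ _).trans (add_le_add (norm_add_le _ _) le_rfl)
    _ < ε := by linarith

theorem tendsto_smul_res_res (hdense : IsDenselyDefined S) (hbis : IsBisectorial S) (x : X) :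
    Tendsto (fun t : ℝ => ((-(t * I : ℂ)) ^ 2) • res S (t * I) (res S (t * I) x)) atTop (𝓝 x) := by
  have h1 := tendsto_smul_res hdense hbis x
  obtain ⟨M, hM⟩ := hbis
  have h2 : Tendsto (fun t : ℝ => M * ‖(-(t * I : ℂ)) • res S (t * I) x - x‖) atTop (𝓝 0) := by
    simpa using (tendsto_iff_norm_sub_tendsto_zero.1 h1).const_mul M
  -- With T the rescaled resolvent, T²x = T(Tx - x) + Tx, and ‖T‖ ≤ M makes the first term vanish in
  -- the limit.
  have h3 : Tendsto (fun t : ℝ =>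
      (-(t * I : ℂ)) • res S (t * I) ((-(t * I : ℂ)) • res S (t * I) x - x)) atTop (𝓝 0) := by
    refine squeeze_zero_norm' ?_ h2
    filter_upwards [eventually_gt_atTop (0 : ℝ)] with t ht
    have hb := (hM (t * I) (by simp) (by simpa using ht.ne')).2
    have hn : ‖(t * I : ℂ)‖ = t := by simp [abs_of_pos ht]
    rw [norm_smul, norm_neg, hn]
    rw [hn, le_div_iff₀ ht] at hb
    calc t * ‖res S (t * I) ((-(t * I : ℂ)) • res S (t * I) x - x)‖
        ≤ t * (‖res S (t * I)‖ * ‖(-(t * I : ℂ)) • res S (t * I) x - x‖) := by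
          gcongr; exact ContinuousLinearMap.le_opNorm _ _
      _ = (‖res S (t * I)‖ * t) * ‖(-(t * I : ℂ)) • res S (t * I) x - x‖ := by ring
      _ ≤ _ := by gcongr
  have h4 := h3.add h1
  rw [zero_add] at h4
  refine h4.congr fun t => ?_
  rw [map_sub, map_smul, smul_sub, sub_add_cancel, smul_smul, sq]

/-- For `x ∈ G₊`, the vectors `(S - l)⁻² x` lie in the range of `A₊`. -/
theorem StripBounded.res_res_mem_range [CompleteSpace X] (hS : StripBounded S h) {x : X}
    (hx : x ∈ Gplus S) {l : ℂ} (hl : l ∈ rho S) :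
    ∃ y, Aplus S h y = res S l (res S l x) := by
  have h0 := hS.zero_mem_rho
  have hA := hS.Aplus_eq_of_mem_Gplus hx
  have key : ∀ z : X, res S l z = res S 0 z + l • res S l (res S 0 z) := fun z => by
    rw [res_commute hl h0]
    simpa using res_apply_eq h0 hl z
  -- The witness is (1 + l R(l))²x: `key` reads R(l) = (1 + l R(l)) R(0), and A₊ commutes with R(l).
  refine ⟨x + l • res S l x + l • res S l (x + l • res S l x), ?_⟩
  simp only [map_add, map_smul, hS.Aplus_res hl, hA]
  rw [key x]
  simp only [map_add, map_smul]
  rw [key (res S 0 x)]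
  simp only [map_add, map_smul]

theorem StripBounded.Mplus_eq_Gplus [CompleteSpace X] (hS : StripBounded S h)
    (hdense : IsDenselyDefined S) (hbis : IsBisectorial S) : Mplus S h = Gplus S := by
  apply le_antisymm
  · refine Submodule.topologicalClosure_minimal _ ?_ hS.isClosed_Gplus
    rintro _ ⟨y, rfl⟩
    exact hS.Aplus_mem_Gplus y
  · intro x hx
    refine mem_closure_of_tendsto (tendsto_smul_res_res hdense hbis x)
      (Eventually.of_forall fun t => ?_)
    obtain ⟨y, hy⟩ := hS.res_res_mem_range hx (l := t * I) (hS.2.1 _ (by simpa using hS.1.le))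
    exact ⟨(-(t * I : ℂ)) ^ 2 • y, by
      rw [map_smul]
      exact congrArg _ hy⟩

theorem StripBounded.isDenselyDefined_restr_Gplus [CompleteSpace X] (hS : StripBounded S h)
    (hdense : IsDenselyDefined S) (hbis : IsBisectorial S) :
    IsDenselyDefined (restr S (Gplus S)) := by
  intro x
  have hmem : ∀ t : ℝ, (t * I : ℂ) ∈ rho S := fun t => hS.2.1 _ (by simpa using hS.1.le)
  have hG : ∀ t : ℝ, (-(t * I : ℂ)) ^ 2 • res S (t * I) (res S (t * I) (x : X)) ∈ Gplus S := by
    intro t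
    obtain ⟨y, hy⟩ := hS.res_res_mem_range x.2 (hmem t)
    rw [← hy]
    exact (Gplus S).smul_mem _ (hS.Aplus_mem_Gplus y)
  have hlim : Tendsto (fun t : ℝ => (⟨_, hG t⟩ : Gplus S)) atTop (𝓝 x) := by
    rw [tendsto_subtype_rng]
    exact tendsto_smul_res_res hdense hbis x
  refine mem_closure_of_tendsto hlim (Eventually.of_forall fun t => ?_)
  exact S.domain.smul_mem _ (res_mem_domain (hmem t) _)

/-! ### The reflection `S ↦ -S` -/

theorem IsResolventAt.neg {l : ℂ} {R : X →L[ℂ] X} (hR : IsResolventAt S l R) :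
    IsResolventAt (-S) (-l) (-R) := by
  refine ⟨fun x => ?_, fun x => ?_⟩
  · obtain ⟨hx, e⟩ := hR.1 x
    have hx' : (-R) x ∈ (-S).domain := S.domain.neg_mem hx
    refine ⟨hx', ?_⟩
    rw [LinearPMap.neg_apply]
    have : (⟨(-R) x, hx'⟩ : S.domain) = -⟨R x, hx⟩ := rfl
    refine Eq.trans ?_ e
    rw [this, LinearPMap.map_neg]
    simp
  · have := hR.2 x
    rw [LinearPMap.neg_apply]
    refine Eq.trans ?_ this
    rw [neg_apply, ← map_neg]
    congr 1
    module

theorem mem_rho_neg_iff {l : ℂ} : l ∈ rho (-S) ↔ -l ∈ rho S := by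
  constructor
  · rintro ⟨R, hR⟩
    simpa using hR.neg.mem_rho
  · rintro ⟨R, hR⟩
    simpa using hR.neg.mem_rho

theorem res_neg (S : X →ₗ.[ℂ] X) (l : ℂ) : res (-S) l = -res S (-l) := by
  by_cases hl : -l ∈ rho S
  · simpa using (isResolventAt_res hl).neg.res_eq
  · have hl' : l ∉ rho (-S) := fun h' => hl (mem_rho_neg_iff.1 h')
    have e1 : res S (-l) = 0 := dif_neg hl
    have e2 : res (-S) l = 0 := dif_neg hl'
    rw [e1, e2, neg_zero]

theorem IsBisectorial.neg (hS : IsBisectorial S) : IsBisectorial (-S) := by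
  obtain ⟨M, hM⟩ := hS
  refine ⟨M, fun l hl hl0 => ?_⟩
  obtain ⟨h1, h2⟩ := hM (-l) (by simpa using hl) (neg_ne_zero.2 hl0)
  exact ⟨mem_rho_neg_iff.2 h1, by simpa [res_neg] using h2⟩

theorem StripBounded.neg (hS : StripBounded S h) : StripBounded (-S) h := by
  obtain ⟨hh, h1, M, hM⟩ := hS
  refine ⟨hh, fun l hl => mem_rho_neg_iff.2 (h1 _ (by simpa using hl)), M, fun l hl => ?_⟩
  rw [res_neg, norm_neg]
  exact hM _ (by simpa using hl)

/-- If f extends an orbit of one operator, l ↦ -f(-l) extends the orbit of its negative, and l ↦ -l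
swaps the half-planes. -/
theorem Gplus_neg (S : X →ₗ.[ℂ] X) : Gplus (-S) = Gminus S := by
  ext x
  constructor
  · rintro ⟨f, hf, hfx, C, hC⟩
    refine ⟨fun l => -f (-l), fun l hl => ?_, fun l hl => ?_, C, fun l hl => ?_⟩
    · refine AnalyticAt.neg (AnalyticAt.fun_comp (hf (-l) ?_) analyticAt_id.neg)
      exact hl.imp (fun h' => by simpa using h') fun h' => by simpa [mem_rho_neg_iff] using h'
    · simp [hfx (-l) (by simpa [mem_rho_neg_iff] using hl), res_neg]
    · rw [norm_neg]
      exact hC (-l) (by simpa using hl)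
  · rintro ⟨f, hf, hfx, C, hC⟩
    refine ⟨fun l => -f (-l), fun l hl => ?_, fun l hl => ?_, C, fun l hl => ?_⟩
    · refine AnalyticAt.neg (AnalyticAt.fun_comp (hf (-l) ?_) analyticAt_id.neg)
      exact hl.imp (fun h' => by simpa using h') fun h' => mem_rho_neg_iff.1 h'
    · simp [hfx (-l) (mem_rho_neg_iff.1 hl), res_neg]
    · rw [norm_neg]
      exact hC (-l) (by simpa using hl)

/-- The weight l⁻² is even, so the sign in `res_neg` is the only one left after t ↦ -t; it is the
sign in the definition of A₋. -/
theorem Aplus_neg (S : X →ₗ.[ℂ] X) (h : ℝ) : Aplus (-S) h = Aminus S h := by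
  have e : ∫ t : ℝ, integrand (-S) (h + t * I) = -∫ t : ℝ, integrand S ((-h : ℝ) + t * I) := by
    rw [← integral_neg_eq_self, ← integral_neg]
    congr 1 with t : 1
    have e1 : (-h : ℝ) + (t : ℂ) * I = -(h + (-t : ℝ) * I) := by push_cast; ring
    rw [e1, integrand, integrand, res_neg, neg_sq, smul_neg]
  rw [Aplus, Aminus, lineIntegral, lineIntegral, e, smul_neg, smul_neg, neg_div, neg_smul]

theorem Mplus_neg (S : X →ₗ.[ℂ] X) (h : ℝ) : Mplus (-S) h = Mminus S h := by
  rw [Mplus, Mminus, Aplus_neg]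

end UnboundedOp

end

theorem lemma6p5 {X : Type*} [NormedAddCommGroup X] [NormedSpace ℂ X] [CompleteSpace X]
    (S : X →ₗ.[ℂ] X) (hdense : UnboundedOp.IsDenselyDefined S)
    (hbis : UnboundedOp.IsBisectorial S) (h0 : (0 : ℂ) ∈ UnboundedOp.rho S) :
    UnboundedOp.IsDenselyDefined (UnboundedOp.restr S (UnboundedOp.Gplus S)) ∧
    UnboundedOp.IsDenselyDefined (UnboundedOp.restr S (UnboundedOp.Gminus S)) ∧
    (∃ h : ℝ, UnboundedOp.StripBounded S h) ∧
    ∀ h : ℝ, UnboundedOp.StripBounded S h →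
      Complex.VerticalIntegrable (UnboundedOp.integrand S) h ∧
      Complex.VerticalIntegrable (UnboundedOp.integrand S) (-h) ∧
      UnboundedOp.Mplus S h = UnboundedOp.Gplus S ∧
      UnboundedOp.Mminus S h = UnboundedOp.Gminus S := by
  obtain ⟨k, hk⟩ := UnboundedOp.exists_stripBounded hbis h0
  have hdense' : UnboundedOp.IsDenselyDefined (-S) := hdense
  refine ⟨hk.isDenselyDefined_restr_Gplus hdense hbis, ?_, ⟨k, hk⟩, fun h hh => ⟨?_, ?_, ?_, ?_⟩⟩
  · rw [← UnboundedOp.Gplus_neg]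
    exact hk.neg.isDenselyDefined_restr_Gplus hdense' hbis.neg
  · exact hh.integrable_integrand hh.1.ne' hh.abs_self_le
  · exact hh.integrable_integrand (neg_ne_zero.2 hh.1.ne') (by rw [abs_neg]; exact hh.abs_self_le)
  · exact hh.Mplus_eq_Gplus hdense hbis
  · rw [← UnboundedOp.Gplus_neg, ← UnboundedOp.Mplus_neg]
    exact hh.neg.Mplus_eq_Gplus hdense' hbis.neg
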